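/- Let $D=(V,A)$ be a finite digraph (parallel edges allowed), let $m:V\to\mathbf Z$ satisfy $\sum_{v\in V}m(v)=0$, and let $f:A\to\mathbf Z\cup\{-\infty\}$ and $g:A\to\mathbf Z\cup\{+\infty\}$ satisfy $f\le g$. An edge enters a set $Z\subseteq V$ if its head is in $Z$ and its tail is not, and leaves $Z$ if its tail is in $Z$ and its head is not. For a function $x$ on $A$, let $\varrho_x(Z)$ and $\delta_x(Z)$ denote the sum of $x$ over the edges entering, respectively leaving, $Z$. An integer-valued $(f,g)$-bounded $m$-flow is a vector $x\in\mathbf Z^A$ with $f\le x\le g$ and $\varrho_x(\{v\})-\delta_x(\{v\})=m(v)$ for every $v\in V$. Let $L\subseteq A$ be such that $-\infty<f(e)<g(e)<+\infty$ for every $e\in L$. An integer-valued $(f,g)$-bounded $m$-flow $x$ is an $L$-upper-minimizer if the number of edges $e\in L$ with $x(e)=g(e)$ is as small as possible among all integer-valued $(f,g)$-bounded $m$-flows. Then there is a (possibly empty) chain of subsets $V_1\supset V_2\supset\cdots\supset V_q$ of $V$ (strict inclusions), with $\varrho_g(V_i)-\delta_f(V_i)<+\infty$ for every $i$, such that an integer-valued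 $(f,g)$-bounded $m$-flow $z$ is an $L$-upper-minimizer if and only if the following five conditions all hold: (O1) $z(e)=f(e)$ for every edge $e\in A$ leaving some $V_i$; (O2) $z(e)=g(e)$ for every edge $e\in A\setminus L$ entering some $V_i$; (O3) $g(e)-1\le z(e)\le g(e)$ for every edge $e\in L$ entering exactly one $V_i$; (O4) $z(e)=g(e)$ for every edge $e\in L$ entering at least two of the $V_i$; (O5) $f(e)\le z(e)\le g(e)-1$ for every edge $e\in L$ neither entering nor leaving any $V_i$. -/

import Mathlib

/-- A directed graph with node set `V` and edge set `A`; parallel edges (and loops) are allowed. -/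
structure DirMultigraph (V A : Type*) where
  tail : A → V
  head : A → V

namespace DirMultigraph

variable {V A : Type*} [DecidableEq V] (D : DirMultigraph V A)

/-- The edge `e` enters the node set `Z`. -/
def Enters (e : A) (Z : Finset V) : Prop := D.tail e ∉ Z ∧ D.head e ∈ Z

/-- The edge `e` leaves the node set `Z`. -/
def Leaves (e : A) (Z : Finset V) : Prop := D.tail e ∈ Z ∧ D.head e ∉ Z

instance (e : A) (Z : Finset V) : Decidable (D.Enters e Z) :=
  inferInstanceAs (Decidable (_ ∧ _))

instance (e : A) (Z : Finset V) : Decidable (D.Leaves e Z) :=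
  inferInstanceAs (Decidable (_ ∧ _))

/-- `ϱ_x(Z)`: the sum of `x` over the edges entering `Z`. -/
def inSum [Fintype A] {M : Type*} [AddCommMonoid M] (x : A → M) (Z : Finset V) : M :=
  ∑ e with D.Enters e Z, x e

/-- `δ_x(Z)`: the sum of `x` over the edges leaving `Z`. -/
def outSum [Fintype A] {M : Type*} [AddCommMonoid M] (x : A → M) (Z : Finset V) : M :=
  ∑ e with D.Leaves e Z, x e

/-- The integral vector `x` is an `m`-flow: `ϱ_x(v) - δ_x(v) = m(v)` at each node `v`. -/
def IsModFlow [Fintype A] (m : V → ℤ) (x : A → ℤ) : Prop :=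
  ∀ v, D.inSum x {v} - D.outSum x {v} = m v

/-- The integral vector `x` is an `(f,g)`-bounded `m`-flow. -/
def IsFeasible [Fintype A] (f : A → WithBot ℤ) (g : A → WithTop ℤ) (m : V → ℤ)
    (x : A → ℤ) : Prop :=
  D.IsModFlow m x ∧ ∀ e, f e ≤ (x e : WithBot ℤ) ∧ (x e : WithTop ℤ) ≤ g e

/-- The set of `g`-saturated edges in `L`. -/
def saturated (L : Finset A) (g : A → WithTop ℤ) (x : A → ℤ) : Finset A :=
  {e ∈ L | (x e : WithTop ℤ) = g e}

/-- `z` is an `L`-upper-minimizer: an integral `(f,g)`-bounded `m`-flow for which the number of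
`g`-saturated edges in `L` is as small as possible. -/
def IsUpperMinimizer [Fintype A] (f : A → WithBot ℤ) (g : A → WithTop ℤ) (m : V → ℤ)
    (L : Finset A) (z : A → ℤ) : Prop :=
  D.IsFeasible f g m z ∧
    ∀ x, D.IsFeasible f g m x → (saturated L g z).card ≤ (saturated L g x).card

/-- The number of members of the family `W` entered by `e`. -/
def numEntered {q : ℕ} (W : Fin q → Finset V) (e : A) : ℕ :=
  (Finset.univ.filter fun i => D.Enters e (W i)).card

end DirMultigraph

/-- The inclusion of `ℤ ∪ {-∞}` in the extended reals. -/
noncomputable def lowerToEReal (a : WithBot ℤ) : EReal :=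
  WithBot.recBotCoe (C := fun _ => EReal) ⊥ (fun n : ℤ => ((n : ℝ) : EReal)) a

/-- The inclusion of `ℤ ∪ {+∞}` in the extended reals. -/
noncomputable def upperToEReal (b : WithTop ℤ) : EReal :=
  WithTop.recTopCoe (C := fun _ => EReal) ⊤ (fun n : ℤ => ((n : ℝ) : EReal)) b

/-- `b - 1` for `b` in `ℤ ∪ {+∞}`, where `+∞ - 1 = +∞`. -/
def upperPred (b : WithTop ℤ) : WithTop ℤ := b.map fun n => n - 1

/-!
Counting `g`-saturated edges of `L` is a separable convex cost: on `e ∈ L` the cost of the value `y`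
is `0` for `y < g e` and `1` for `y = g e`.  The theorem is complementary slackness for the
resulting minimum cost flow problem.

*Existence of a dual solution.*  Take one upper-minimizer `z₀` and its residual arcs, each weighted
by the change of cost caused by augmenting `z₀` by one unit along it.  Augmenting along a closed
trail of residual arcs gives another feasible flow, so by convexity and minimality no closed trail
has negative weight (`cost_nonneg_of_closed_trail`).  Hence the minimum weight of a trail ending at
`v` is a feasible potential `π v` (`exists_potential`).  The chain consists of the level sets of
`π`, one for each value that `π` takes (`levelSet`), and `z₀` satisfies the optimality
criteria with respect to it (`slack_levelSet`): skipping the values not attained by `π` only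
weakens the criteria.

*Optimality criteria.*  For a chain `W`, put `p v = #{i | v ∈ W i}`.  For an `m`-flow `z`, the sum
of `(p (head e) - p (tail e)) * z e` is the constant `∑ v, p v * m v` (`IsModFlow.sum_mul`), so
minimizing the cost amounts to minimizing the sum of the reduced costs
`cost e (z e) - (p (head e) - p (tail e)) * z e`.  The criteria at `e` characterise the minimizers
of the reduced cost of `e` as soon as one feasible value satisfies them (`Slack.reduced_le_and`).
As `z₀` satisfies them on all edges, a feasible `z` is optimal if and only
if it does too.
-/

namespace DirMultigraph

/-! ### Potentials and closed trails -/

section Potential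

variable {V B : Type*} (src tgt : B → V)

/-- The list of arcs `l` is a walk from `u` to `w`. -/
def IsWalk : V → List B → V → Prop
  | u, [], w => u = w
  | u, a :: l, w => src a = u ∧ IsWalk (tgt a) l w

variable {src tgt}

theorem isWalk_append {u w : V} {l₁ l₂ : List B} :
    IsWalk src tgt u (l₁ ++ l₂) w ↔ ∃ v, IsWalk src tgt u l₁ v ∧ IsWalk src tgt v l₂ w := by
  induction l₁ generalizing u with
  | nil => simp [IsWalk]
  | cons a l ih => simp [IsWalk, ih, and_assoc]

theorem isWalk_singleton {u w : V} {a : B} :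
    IsWalk src tgt u [a] w ↔ src a = u ∧ tgt a = w := by
  simp [IsWalk]

theorem IsWalk.sum_sub {u w : V} {l : List B} (h : IsWalk src tgt u l w) (φ : V → ℤ) :
    (l.map fun a => φ (tgt a) - φ (src a)).sum = φ w - φ u := by
  induction l generalizing u with
  | nil => cases h; simp
  | cons a l ih =>
    obtain ⟨rfl, h⟩ := h
    simp [ih h]

/-- If the closed trails (closed walks without repeated arcs) of allowed arcs have nonnegative
weight, then there is a feasible potential, namely the minimum weight of a trail ending at the
given node. -/
theorem exists_potential [Finite B] (R : B → Prop) (c : B → ℤ)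
    (H : ∀ u l, IsWalk src tgt u l u → l.Nodup → (∀ a ∈ l, R a) → 0 ≤ (l.map c).sum) :
    ∃ π : V → ℤ, ∀ a, R a → π (tgt a) ≤ π (src a) + c a := by
  classical
  have := Fintype.ofFinite B
  let T : V → Set (List B) := fun w =>
    {l | l.Nodup ∧ (∀ a ∈ l, R a) ∧ ∃ u, IsWalk src tgt u l w}
  have hfin (w : V) : (T w).Finite :=
    (List.finite_length_le B (Fintype.card B)).subset fun l hl => hl.1.length_le_card
  have hmin (w : V) : ∃ l ∈ T w, ∀ l' ∈ T w, (l.map c).sum ≤ (l'.map c).sum :=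
    Set.exists_min_image _ _ (hfin w) ⟨[], by simp, by simp, w, rfl⟩
  choose P hP hPmin using hmin
  refine ⟨fun w => ((P w).map c).sum, fun a ha => ?_⟩
  obtain ⟨hnd, hR, u, hu⟩ := hP (src a)
  by_cases hmem : a ∈ P (src a)
  · -- Cut the trail after `a`; its second part closes up with `a` to a closed trail.
    obtain ⟨l₁, l₂, hl⟩ := List.append_of_mem hmem
    have hl' : P (src a) = (l₁ ++ [a]) ++ l₂ := by simp [hl]
    rw [hl'] at hnd hR hu
    obtain ⟨v, hv₁, hv₂⟩ := isWalk_append.1 hu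
    obtain ⟨v', -, hv'⟩ := isWalk_append.1 hv₁
    obtain ⟨-, rfl⟩ := isWalk_singleton.1 hv'
    have h₁ := hPmin (tgt a) (l₁ ++ [a])
      ⟨hnd.of_append_left, fun b hb => hR b (List.mem_append_left _ hb), u, hv₁⟩
    have h₂ := H (tgt a) (l₂ ++ [a])
      (isWalk_append.2 ⟨src a, hv₂, isWalk_singleton.2 ⟨rfl, rfl⟩⟩)
      (by
        rw [List.append_assoc] at hnd
        exact (List.perm_append_comm.nodup_iff).1 hnd.of_append_right)
      (fun b hb => hR b (by simp at hb ⊢; tauto))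
    simp only [hl', List.map_append, List.sum_append, List.map_cons, List.map_nil,
      List.sum_cons, List.sum_nil] at h₁ h₂ ⊢
    linarith
  · have h := hPmin (tgt a) (P (src a) ++ [a])
      ⟨by simpa [List.nodup_append, hnd] using fun b hb => ne_of_mem_of_not_mem hb hmem,
        fun b hb => by
          rcases List.mem_append.1 hb with hb | hb
          · exact hR b hb
          · rwa [List.mem_singleton.1 hb],
        u, isWalk_append.2 ⟨_, hu, isWalk_singleton.2 ⟨rfl, rfl⟩⟩⟩
    simpa using h

end Potential

variable {V A : Type*}

/-! ### Flows and costs -/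

section Flow

variable [DecidableEq V] [Fintype A] (D : DirMultigraph V A)

theorem inSum_sub_outSum_singleton (x : A → ℤ) (v : V) :
    D.inSum x {v} - D.outSum x {v} =
      ∑ e, ((if D.head e = v then 1 else 0) - (if D.tail e = v then 1 else 0)) * x e := by
  simp only [inSum, outSum, Finset.sum_filter, ← Finset.sum_sub_distrib]
  refine Finset.sum_congr rfl fun e _ => ?_
  by_cases h₁ : D.head e = v <;> by_cases h₂ : D.tail e = v <;> simp [Enters, Leaves, h₁, h₂]

variable {D}

/-- The pairing of an `m`-flow with a potential difference does not depend on the flow. -/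
theorem IsModFlow.sum_mul [Fintype V] {m : V → ℤ} {x : A → ℤ} (hx : D.IsModFlow m x)
    (φ : V → ℤ) : ∑ e, (φ (D.head e) - φ (D.tail e)) * x e = ∑ v, φ v * m v := by
  have h (v : V) := (hx v).symm.trans (D.inSum_sub_outSum_singleton x v)
  simp only [h, Finset.mul_sum]
  rw [Finset.sum_comm]
  refine Finset.sum_congr rfl fun e _ => ?_
  simp only [← mul_assoc, ← Finset.sum_mul]
  simp [mul_sub, Finset.sum_sub_distrib]

end Flow

section Cost

variable (L : Finset A) (f : A → WithBot ℤ) (g : A → WithTop ℤ)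

open Classical in
/-- The cost of the value `y` on the edge `e`: it is `1` if `e` is an edge of `L` saturated by `y`,
and `0` otherwise. -/
noncomputable def cost (e : A) (y : ℤ) : ℤ := if e ∈ L ∧ (y : WithTop ℤ) = g e then 1 else 0

theorem sum_cost [Fintype A] (x : A → ℤ) : ∑ e, cost L g e (x e) = (saturated L g x).card := by
  classical
  simp only [cost, Finset.sum_boole, saturated]
  congr 2
  ext e
  simp

/-! ### Augmentation along closed trails -/

/-- The tail of a residual arc; `(e, true)` is the edge `e` and `(e, false)` its reverse. -/
def resSrc (D : DirMultigraph V A) (a : A × Bool) : V := if a.2 then D.tail a.1 else D.head a.1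

/-- The head of a residual arc. -/
def resTgt (D : DirMultigraph V A) (a : A × Bool) : V := if a.2 then D.head a.1 else D.tail a.1

/-- The change of value on the underlying edge when augmenting along a residual arc. -/
def resSign (a : A × Bool) : ℤ := if a.2 then 1 else -1

/-- Augmenting `z` along the arc `a` respects the bounds. -/
def IsResidual (z : A → ℤ) (a : A × Bool) : Prop :=
  f a.1 ≤ ((z a.1 + resSign a : ℤ) : WithBot ℤ) ∧ ((z a.1 + resSign a : ℤ) : WithTop ℤ) ≤ g a.1

/-- The change of cost when augmenting `z` along the arc `a`. -/
noncomputable def resCost (z : A → ℤ) (a : A × Bool) : ℤ :=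
  cost L g a.1 (z a.1 + resSign a) - cost L g a.1 (z a.1)

open Classical in
/-- The result of augmenting `z` by one unit along the arcs of `l`. -/
noncomputable def augment (z : A → ℤ) (l : List (A × Bool)) (e : A) : ℤ :=
  z e + (if (e, true) ∈ l then 1 else 0) - (if (e, false) ∈ l then 1 else 0)

open Classical in
theorem sum_map_arcs [Fintype A] {l : List (A × Bool)} (hl : l.Nodup) (φ : A × Bool → ℤ) :
    (l.map φ).sum = ∑ e, ((if (e, true) ∈ l then φ (e, true) else 0) +
      (if (e, false) ∈ l then φ (e, false) else 0)) := by
  rw [← List.sum_toFinset φ hl]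
  have h : l.toFinset = Finset.univ.filter (· ∈ l) := by ext; simp
  rw [h, Finset.sum_filter, Fintype.sum_prod_type]
  simp

variable {L f g}

theorem isModFlow_augment [DecidableEq V] [Fintype A] {D : DirMultigraph V A} {m : V → ℤ}
    {z : A → ℤ} (hz : D.IsModFlow m z) {u : V} {l : List (A × Bool)}
    (hw : IsWalk (resSrc D) (resTgt D) u l u) (hl : l.Nodup) :
    D.IsModFlow m (augment z l) := by
  classical
  intro v
  rw [← hz v, inSum_sub_outSum_singleton, inSum_sub_outSum_singleton, ← sub_eq_zero,
    ← Finset.sum_sub_distrib]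
  have h := hw.sum_sub fun w => if w = v then 1 else 0
  rw [sub_self, sum_map_arcs hl] at h
  refine (Finset.sum_congr rfl fun e _ => ?_).trans h
  simp only [augment, resSrc, resTgt]
  by_cases h₁ : (e, true) ∈ l <;> by_cases h₂ : (e, false) ∈ l <;> simp [h₁, h₂]
  all_goals ring

theorem isFeasible_augment [DecidableEq V] [Fintype A] {D : DirMultigraph V A} {m : V → ℤ}
    {z : A → ℤ} (hz : D.IsFeasible f g m z) {u : V} {l : List (A × Bool)}
    (hw : IsWalk (resSrc D) (resTgt D) u l u) (hl : l.Nodup) (hR : ∀ a ∈ l, IsResidual f g z a) :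
    D.IsFeasible f g m (augment z l) := by
  classical
  refine ⟨isModFlow_augment hz.1 hw hl, fun e => ?_⟩
  have h := hz.2 e
  by_cases h₁ : (e, true) ∈ l <;> by_cases h₂ : (e, false) ∈ l
  · simpa [augment, h₁, h₂] using h
  · simpa [augment, h₁, h₂, IsResidual, resSign] using hR _ h₁
  · simpa [augment, h₁, h₂, IsResidual, resSign, sub_eq_add_neg] using hR _ h₂
  · simpa [augment, h₁, h₂] using h

theorem sum_cost_augment_le [Fintype A] {z : A → ℤ} {l : List (A × Bool)} (hl : l.Nodup)
    (hR : ∀ a ∈ l, IsResidual f g z a) :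
    ∑ e, cost L g e (augment z l e) ≤ ∑ e, cost L g e (z e) + (l.map (resCost L g z)).sum := by
  classical
  rw [sum_map_arcs hl, ← Finset.sum_add_distrib]
  refine Finset.sum_le_sum fun e _ => ?_
  by_cases h₁ : (e, true) ∈ l <;> by_cases h₂ : (e, false) ∈ l
  · -- The two augmentations cancel; this is the convexity of the cost at `z e`.
    have h := (hR _ h₁).2
    have h0 : cost L g e (z e) = 0 := by
      refine if_neg fun h' => ?_
      rw [← h'.2] at h
      simp only [resSign, if_true, WithTop.coe_le_coe] at h
      omega
    have hnn (y : ℤ) : 0 ≤ cost L g e y := by unfold cost; split_ifs <;> simp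
    have := hnn (z e + 1)
    have := hnn (z e + -1)
    simp [augment, h₁, h₂, resCost, resSign, h0]
    omega
  · simp [augment, h₁, h₂, resCost, resSign]
  · simp [augment, h₁, h₂, resCost, resSign, sub_eq_add_neg]
  · simp [augment, h₁, h₂]

theorem cost_nonneg_of_closed_trail [DecidableEq V] [Fintype A] {D : DirMultigraph V A}
    {m : V → ℤ} {z : A → ℤ} (hz : D.IsUpperMinimizer f g m L z) (u : V) (l : List (A × Bool))
    (hw : IsWalk (resSrc D) (resTgt D) u l u) (hl : l.Nodup) (hR : ∀ a ∈ l, IsResidual f g z a) :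
    0 ≤ (l.map (resCost L g z)).sum := by
  have h₁ := hz.2 _ (isFeasible_augment hz.1 hw hl hR)
  have h₂ := sum_cost_augment_le (L := L) hl hR
  rw [sum_cost, sum_cost] at h₂
  omega

end Cost

/-! ### The optimality criteria at an edge -/

section Slack

variable (L : Finset A) (f : A → WithBot ℤ) (g : A → WithTop ℤ)

/-- The optimality criteria for the value `y` on an edge `e` that enters `k` and leaves `l` members
of a chain.  Bounds that hold for every feasible value are left out. -/
structure Slack (e : A) (k l : ℕ) (y : ℤ) : Prop where
  leaves : 0 < l → (y : WithBot ℤ) = f e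
  enters : e ∉ L → 0 < k → (y : WithTop ℤ) = g e
  enters_one : e ∈ L → k = 1 → upperPred (g e) ≤ (y : WithTop ℤ)
  enters_two : e ∈ L → 2 ≤ k → (y : WithTop ℤ) = g e
  neither : e ∈ L → k = 0 → l = 0 → (y : WithTop ℤ) ≤ upperPred (g e)

theorem upperPred_coe (n : ℤ) : upperPred (n : WithTop ℤ) = ((n - 1 : ℤ) : WithTop ℤ) := rfl

/-- The edges of `L` have finite bounds `F < G`. -/
def FiniteOn : Prop := ∀ e ∈ L, ∃ F G : ℤ, f e = F ∧ g e = G ∧ F < G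

variable {L f g}

theorem finiteOn_of_lt
    (hL : ∀ e ∈ L, ⊥ < f e ∧ lowerToEReal (f e) < upperToEReal (g e) ∧ g e < ⊤) :
    FiniteOn L f g := by
  intro e he
  obtain ⟨h₁, h₂, h₃⟩ := hL e he
  obtain ⟨F, hF⟩ := WithBot.ne_bot_iff_exists.1 h₁.ne'
  obtain ⟨G, hG⟩ := WithTop.ne_top_iff_exists.1 h₃.ne
  refine ⟨F, G, hF.symm, hG.symm, ?_⟩
  rw [← hF, ← hG] at h₂
  have h : ((F : ℝ) : EReal) < ((G : ℝ) : EReal) := h₂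
  exact_mod_cast h

theorem slack_iff_of_mem {e : A} (he : e ∈ L) {F G : ℤ} (hF : f e = F) (hG : g e = G) {k l : ℕ}
    {y : ℤ} : Slack L f g e k l y ↔ (0 < l → y = F) ∧ (k = 1 → G - 1 ≤ y) ∧ (2 ≤ k → y = G) ∧
      (k = 0 → l = 0 → y ≤ G - 1) := by
  constructor
  · rintro ⟨h₁, -, h₃, h₄, h₅⟩
    simp only [he, hF, hG, upperPred_coe, WithTop.coe_le_coe, WithTop.coe_inj, WithBot.coe_inj,
      forall_true_left] at h₁ h₃ h₄ h₅
    exact ⟨h₁, h₃, h₄, h₅⟩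
  · rintro ⟨h₁, h₃, h₄, h₅⟩
    constructor <;> simp only [he, hF, hG, upperPred_coe, WithTop.coe_le_coe, WithTop.coe_inj,
      WithBot.coe_inj, not_true, false_imp_iff, forall_true_left] <;> assumption

theorem slack_iff_of_notMem {e : A} (he : e ∉ L) {k l : ℕ} {y : ℤ} :
    Slack L f g e k l y ↔
      (0 < l → (y : WithBot ℤ) = f e) ∧ (0 < k → (y : WithTop ℤ) = g e) :=
  ⟨fun h => ⟨h.leaves, h.enters he⟩,
    fun h => ⟨h.1, fun _ => h.2, (absurd · he), (absurd · he), (absurd · he)⟩⟩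

theorem cost_of_mem {e : A} (he : e ∈ L) {G : ℤ} (hG : g e = G) (y : ℤ) :
    cost L g e y = if y = G then 1 else 0 := by
  simp [cost, he, hG]

theorem cost_of_notMem {e : A} (he : e ∉ L) (y : ℤ) : cost L g e y = 0 := by
  simp [cost, he]

/-- A value satisfying the criteria minimizes the reduced cost, and every other minimizer satisfies
the criteria. -/
theorem Slack.reduced_le_and (hfin : FiniteOn L f g) {e : A} {k l : ℕ} (hkl : k = 0 ∨ l = 0)
    {y₀ y : ℤ} (h₀ : Slack L f g e k l y₀) (hf₀ : f e ≤ (y₀ : WithBot ℤ))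
    (hg₀ : (y₀ : WithTop ℤ) ≤ g e) (hf : f e ≤ (y : WithBot ℤ)) (hg : (y : WithTop ℤ) ≤ g e) :
    cost L g e y₀ - ((k : ℤ) - l) * y₀ ≤ cost L g e y - ((k : ℤ) - l) * y ∧
      (cost L g e y - ((k : ℤ) - l) * y ≤ cost L g e y₀ - ((k : ℤ) - l) * y₀ ↔
        Slack L f g e k l y) := by
  by_cases he : e ∈ L
  · obtain ⟨F, G, hF, hG, hFG⟩ := hfin e he
    rw [slack_iff_of_mem he hF hG] at h₀ ⊢
    rw [cost_of_mem he hG, cost_of_mem he hG]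
    rw [hF, WithBot.coe_le_coe] at hf hf₀
    rw [hG, WithTop.coe_le_coe] at hg hg₀
    obtain ⟨h₁, h₂, h₃, h₄⟩ := h₀
    rcases Nat.eq_zero_or_pos l with rfl | hl
    · obtain rfl | rfl | hk : k = 0 ∨ k = 1 ∨ 2 ≤ k := by omega
      · simp at *
        split_ifs <;> omega
      · simp at *
        split_ifs <;> omega
      · obtain rfl := h₃ hk
        have hk' : (2 : ℤ) ≤ k := by exact_mod_cast hk
        rcases eq_or_lt_of_le hg with rfl | hlt
        · simp; omega
        · have : (2 : ℤ) * (y₀ - y) ≤ k * (y₀ - y) :=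
            mul_le_mul_of_nonneg_right hk' (by omega)
          rw [if_pos rfl, if_neg hlt.ne]
          simp only [Nat.cast_zero, sub_zero]
          rw [mul_sub (k : ℤ)] at this
          refine ⟨by omega, fun h => by omega, fun h => ?_⟩
          exact absurd (h.2.2.1 hk) hlt.ne
    · obtain rfl := h₁ hl
      obtain rfl : k = 0 := by omega
      have hl' : (1 : ℤ) ≤ l := by exact_mod_cast hl
      have : (1 : ℤ) * (y - y₀) ≤ l * (y - y₀) := mul_le_mul_of_nonneg_right hl' (by omega)
      rw [if_neg hFG.ne]
      simp only [Nat.cast_zero, zero_sub, neg_mul, sub_neg_eq_add]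
      rw [mul_sub (l : ℤ)] at this
      refine ⟨by split_ifs <;> omega, fun h => ?_, fun h => ?_⟩
      · have : y = y₀ := by split_ifs at h <;> omega
        simp [this]; omega
      · obtain rfl := h.1 hl
        simp [hFG.ne]
  · rw [slack_iff_of_notMem he] at h₀ ⊢
    rw [cost_of_notMem he, cost_of_notMem he]
    obtain ⟨h₁, h₂⟩ := h₀
    rcases Nat.eq_zero_or_pos k with rfl | hk
    · rcases Nat.eq_zero_or_pos l with rfl | hl
      · simp
      · have hl' : (0 : ℤ) < l := by exact_mod_cast hl
        rw [← h₁ hl] at hf ⊢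
        rw [WithBot.coe_le_coe] at hf
        simp only [Nat.cast_zero, zero_sub, neg_mul, sub_neg_eq_add,
          mul_le_mul_iff_right₀ hl', WithBot.coe_inj, zero_add]
        refine ⟨hf, fun h => ⟨fun _ => le_antisymm h hf, by simp⟩, fun h => (h.1 hl).le⟩
    · obtain rfl : l = 0 := by omega
      have hk' : (0 : ℤ) < k := by exact_mod_cast hk
      rw [← h₂ hk] at hg ⊢
      rw [WithTop.coe_le_coe] at hg
      simp only [Nat.cast_zero, sub_zero, zero_sub, neg_le_neg_iff,
        mul_le_mul_iff_right₀ hk', WithTop.coe_inj]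
      exact ⟨hg, fun h => ⟨by simp, fun _ => le_antisymm hg h⟩, fun h => (h.2 hk).ge⟩

end Slack

/-! ### Chains and their potentials -/

section Chain

variable [DecidableEq V] (D : DirMultigraph V A) {q : ℕ} (W : Fin q → Finset V)

/-- The number of members of the family `W` left by `e`. -/
def numLeft (e : A) : ℕ := (Finset.univ.filter fun i => D.Leaves e (W i)).card

/-- The number of members of the family `W` containing `v`. -/
def depth (v : V) : ℕ := (Finset.univ.filter fun i => v ∈ W i).card

variable {D W}

theorem numEntered_pos {e : A} : 0 < D.numEntered W e ↔ ∃ i, D.Enters e (W i) := by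
  simp [numEntered, Finset.card_pos, Finset.filter_nonempty_iff]

theorem numLeft_pos {e : A} : 0 < D.numLeft W e ↔ ∃ i, D.Leaves e (W i) := by
  simp [numLeft, Finset.card_pos, Finset.filter_nonempty_iff]

theorem depth_head_sub_depth_tail (e : A) :
    (depth W (D.head e) : ℤ) - depth W (D.tail e) = D.numEntered W e - D.numLeft W e := by
  simp only [depth, numEntered, numLeft, Finset.card_filter, Nat.cast_sum,
    ← Finset.sum_sub_distrib]
  refine Finset.sum_congr rfl fun i _ => ?_
  by_cases h₁ : D.head e ∈ W i <;> by_cases h₂ : D.tail e ∈ W i <;> simp [Enters, Leaves, h₁, h₂]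

theorem numEntered_eq_zero_or_numLeft_eq_zero (hW : Antitone W) (e : A) :
    D.numEntered W e = 0 ∨ D.numLeft W e = 0 := by
  by_contra! h
  obtain ⟨i, hi⟩ := numEntered_pos.1 (Nat.pos_of_ne_zero h.1)
  obtain ⟨j, hj⟩ := numLeft_pos.1 (Nat.pos_of_ne_zero h.2)
  rcases le_total i j with hij | hij
  · exact hi.1 (hW hij hj.1)
  · exact hj.2 (hW hij hi.2)

variable {L : Finset A} {f : A → WithBot ℤ} {g : A → WithTop ℤ}

/-- Complementary slackness: if some feasible flow satisfies the criteria for a chain, then the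
minimizers are exactly the feasible flows that satisfy them. -/
theorem isUpperMinimizer_iff_slack [Fintype V] [Fintype A] {m : V → ℤ}
    (hfin : FiniteOn L f g) (hW : Antitone W) {z₀ : A → ℤ} (hz₀ : D.IsFeasible f g m z₀)
    (hs : ∀ e, Slack L f g e (D.numEntered W e) (D.numLeft W e) (z₀ e))
    {z : A → ℤ} (hz : D.IsFeasible f g m z) :
    D.IsUpperMinimizer f g m L z ↔
      ∀ e, Slack L f g e (D.numEntered W e) (D.numLeft W e) (z e) := by
  let r : (A → ℤ) → A → ℤ := fun x e =>
    cost L g e (x e) - ((D.numEntered W e : ℤ) - D.numLeft W e) * x e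
  have hr {x : A → ℤ} (hx : D.IsFeasible f g m x) :
      ∑ e, r x e = (saturated L g x).card - ∑ v, (depth W v : ℤ) * m v := by
    rw [← hx.1.sum_mul fun v => (depth W v : ℤ), Finset.sum_sub_distrib, sum_cost]
    simp only [depth_head_sub_depth_tail]
  have key {x : A → ℤ} (hx : D.IsFeasible f g m x) (e : A) := (hs e).reduced_le_and hfin
    (numEntered_eq_zero_or_numLeft_eq_zero hW e) (hz₀.2 e).1 (hz₀.2 e).2 (hx.2 e).1 (hx.2 e).2
  have hle {x : A → ℤ} (hx : D.IsFeasible f g m x) : ∑ e, r z₀ e ≤ ∑ e, r x e :=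
    Finset.sum_le_sum fun e _ => (key hx e).1
  constructor
  · intro h e
    have h₁ : ∑ e, r z₀ e = ∑ e, r z e := by
      refine le_antisymm (hle hz) ?_
      rw [hr hz, hr hz₀]
      have := h.2 z₀ hz₀
      omega
    have h₂ := (Finset.sum_eq_sum_iff_of_le fun e _ => (key hz e).1).1 h₁ e (Finset.mem_univ e)
    exact (key hz e).2.1 h₂.ge
  · intro h
    refine ⟨hz, fun x hx => ?_⟩
    have h₁ : ∑ e, r z e ≤ ∑ e, r z₀ e := Finset.sum_le_sum fun e _ => (key hz e).2.2 (h e)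
    have h₂ := h₁.trans (hle hx)
    rw [hr hz, hr hx] at h₂
    omega

end Chain

/-! ### The level sets of an optimal potential -/

section LevelSets

variable [Fintype V] (π : V → ℤ)

/-- The upper level sets of `π`, one for each value of `π`, in increasing order of the values.
The lowest one is all of `V`, which no edge enters or leaves. -/
noncomputable def levelSet (i : Fin (Finset.univ.image π).card) : Finset V :=
  {v | (Finset.univ.image π).orderEmbOfFin rfl i ≤ π v}

variable {π}

theorem mem_levelSet {i : Fin (Finset.univ.image π).card} {v : V} :
    v ∈ levelSet π i ↔ (Finset.univ.image π).orderEmbOfFin rfl i ≤ π v := by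
  simp [levelSet]

theorem levelSet_strictAnti : StrictAnti (levelSet π) := by
  intro i j hij
  have h := ((Finset.univ.image π).orderEmbOfFin rfl).strictMono hij
  refine Finset.ssubset_iff_subset_ne.2 ⟨fun v hv => ?_, fun heq => ?_⟩
  · exact mem_levelSet.2 (h.le.trans (mem_levelSet.1 hv))
  · obtain ⟨v, -, hv⟩ := Finset.mem_image.1
      ((Finset.univ.image π).orderEmbOfFin_mem rfl i)
    have h' : v ∈ levelSet π j := heq ▸ mem_levelSet.2 hv.ge
    rw [mem_levelSet, hv] at h'
    exact absurd h h'.not_gt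

variable {D : DirMultigraph V A}

theorem lt_of_enters_levelSet {e : A} (h : ∃ i, D.Enters e (levelSet π i)) :
    π (D.tail e) < π (D.head e) := by
  obtain ⟨i, h₁, h₂⟩ := h
  rw [mem_levelSet] at h₁ h₂
  omega

theorem lt_of_leaves_levelSet {e : A} (h : ∃ i, D.Leaves e (levelSet π i)) :
    π (D.head e) < π (D.tail e) := by
  obtain ⟨i, h₁, h₂⟩ := h
  rw [mem_levelSet] at h₁ h₂
  omega

variable [DecidableEq V]

theorem add_two_le_of_two_le_numEntered {e : A} (h : 2 ≤ D.numEntered (levelSet π) e) :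
    π (D.tail e) + 2 ≤ π (D.head e) := by
  obtain ⟨i, hi, j, hj, hij⟩ := Finset.one_lt_card.1 h
  simp only [Finset.mem_filter_univ, Enters, mem_levelSet] at hi hj
  have := ((Finset.univ.image π).orderEmbOfFin rfl).injective.ne hij
  omega

theorem eq_of_numEntered_eq_zero {e : A} (h₁ : D.numEntered (levelSet π) e = 0)
    (h₂ : D.numLeft (levelSet π) e = 0) : π (D.head e) = π (D.tail e) := by
  have key (v : V) : ∃ i, (Finset.univ.image π).orderEmbOfFin rfl i = π v := by
    have : π v ∈ Set.range ((Finset.univ.image π).orderEmbOfFin rfl) := by simp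
    exact this
  by_contra hne
  -- The larger end value is itself one of the levels, and its level set separates the ends.
  rcases lt_or_gt_of_ne hne with h | h
  · obtain ⟨i, hi⟩ := key (D.tail e)
    exact (numLeft_pos.2 ⟨i, by simp [Leaves, mem_levelSet, hi, h]⟩).ne' h₂
  · obtain ⟨i, hi⟩ := key (D.head e)
    exact (numEntered_pos.2 ⟨i, by simp [Enters, mem_levelSet, hi, h]⟩).ne' h₁

variable {L : Finset A} {f : A → WithBot ℤ} {g : A → WithTop ℤ}

/-- The bounds on the potential difference along `e` given by the two residual arcs of `e` imply the
optimality criteria for the chain of level sets. -/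
theorem slack_levelSet (hfin : FiniteOn L f g) {z : A → ℤ}
    (hz : ∀ e, f e ≤ (z e : WithBot ℤ) ∧ (z e : WithTop ℤ) ≤ g e)
    (hπ : ∀ a, IsResidual f g z a → π (resTgt D a) ≤ π (resSrc D a) + resCost L g z a) (e : A) :
    Slack L f g e (D.numEntered (levelSet π) e) (D.numLeft (levelSet π) e) (z e) := by
  have hfwd := hπ (e, true)
  have hbwd := hπ (e, false)
  have hk := fun h => lt_of_enters_levelSet (numEntered_pos.1 (h : 0 < D.numEntered (levelSet π) e))
  have hl := fun h => lt_of_leaves_levelSet (numLeft_pos.1 (h : 0 < D.numLeft (levelSet π) e))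
  have hk2 := add_two_le_of_two_le_numEntered (D := D) (π := π) (e := e)
  have h0 := eq_of_numEntered_eq_zero (D := D) (π := π) (e := e)
  obtain ⟨h₁, h₂⟩ := hz e
  simp only [IsResidual, resTgt, resSrc, resCost, resSign, if_true, Bool.false_eq_true,
    if_false] at hfwd hbwd
  by_cases he : e ∈ L
  · obtain ⟨F, G, hF, hG, hFG⟩ := hfin e he
    rw [slack_iff_of_mem he hF hG]
    rw [cost_of_mem he hG, cost_of_mem he hG, hF, hG, WithBot.coe_le_coe, WithTop.coe_le_coe]
      at hfwd hbwd
    rw [hF, WithBot.coe_le_coe] at h₁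
    rw [hG, WithTop.coe_le_coe] at h₂
    refine ⟨fun h => ?_, fun h => ?_, fun h => ?_, fun h h' => ?_⟩
    · have := hl h
      by_contra hne
      have := hbwd ⟨by omega, by omega⟩
      split_ifs at this <;> omega
    · have := hk (by omega)
      by_contra hne
      have := hfwd ⟨by omega, by omega⟩
      split_ifs at this <;> omega
    · have := hk2 h
      by_contra hne
      have := hfwd ⟨by omega, by omega⟩
      split_ifs at this <;> omega
    · have := h0 h h'
      by_contra hne
      have := hbwd ⟨by omega, by omega⟩
      split_ifs at this <;> omega
  · rw [slack_iff_of_notMem he]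
    simp only [cost_of_notMem he, sub_zero, add_zero] at hfwd hbwd
    constructor
    · intro h
      by_contra hne
      have hlt := lt_of_le_of_ne h₁ (Ne.symm hne)
      refine (hbwd ⟨?_, le_trans (WithTop.coe_le_coe.2 (by omega)) h₂⟩).not_gt (hl h)
      cases hf : f e with
      | bot => exact bot_le
      | coe F =>
        rw [hf, WithBot.coe_lt_coe] at hlt
        exact WithBot.coe_le_coe.2 (by omega)
    · intro h
      by_contra hne
      have hlt := lt_of_le_of_ne h₂ hne
      refine (hfwd ⟨le_trans h₁ (WithBot.coe_le_coe.2 (by omega)), ?_⟩).not_gt (hk h)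
      cases hg : g e with
      | top => exact le_top
      | coe G =>
        rw [hg, WithTop.coe_lt_coe] at hlt
        exact WithTop.coe_le_coe.2 (by omega)

end LevelSets

/-! ### Finiteness of the cuts -/

section Finiteness

theorem withBot_sum_ne_bot {ι : Type*} (s : Finset ι) (h : ι → WithBot ℤ)
    (hs : ∀ i ∈ s, h i ≠ ⊥) : ∑ i ∈ s, h i ≠ ⊥ := by
  classical
  induction s using Finset.induction_on with
  | empty => simp
  | insert a s ha ih =>
    rw [Finset.sum_insert ha]
    exact WithBot.add_ne_bot.2 ⟨hs a (by simp), ih fun i hi => hs i (by simp [hi])⟩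

theorem upperToEReal_sub_lowerToEReal_lt_top {a : WithTop ℤ} {b : WithBot ℤ} (ha : a ≠ ⊤)
    (hb : b ≠ ⊥) : upperToEReal a - lowerToEReal b < ⊤ := by
  obtain ⟨n, rfl⟩ := WithTop.ne_top_iff_exists.1 ha
  obtain ⟨k, rfl⟩ := WithBot.ne_bot_iff_exists.1 hb
  change ((n : ℝ) : EReal) - ((k : ℝ) : EReal) < ⊤
  rw [← EReal.coe_sub]
  exact EReal.coe_lt_top _

theorem cut_lt_top_of_slack [DecidableEq V] [Fintype A] {D : DirMultigraph V A} {L : Finset A}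
    {f : A → WithBot ℤ} {g : A → WithTop ℤ} (hfin : FiniteOn L f g) {q : ℕ}
    {W : Fin q → Finset V} {z : A → ℤ}
    (hs : ∀ e, Slack L f g e (D.numEntered W e) (D.numLeft W e) (z e)) (i : Fin q) :
    upperToEReal (D.inSum g (W i)) - lowerToEReal (D.outSum f (W i)) < ⊤ := by
  refine upperToEReal_sub_lowerToEReal_lt_top ?_ ?_
  · refine WithTop.sum_ne_top.2 fun e he => ?_
    by_cases heL : e ∈ L
    · obtain ⟨F, G, -, hG, -⟩ := hfin e heL
      simp [hG]
    · rw [← (hs e).enters heL (numEntered_pos.2 ⟨i, by simpa using he⟩)]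
      exact WithTop.coe_ne_top
  · refine withBot_sum_ne_bot _ _ fun e he => ?_
    rw [← (hs e).leaves (numLeft_pos.2 ⟨i, by simpa using he⟩)]
    exact WithBot.coe_ne_bot

end Finiteness

end DirMultigraph

open DirMultigraph in
theorem mainTheorem6 {V A : Type*} [Fintype V] [DecidableEq V] [Fintype A]
    (D : DirMultigraph V A) (f : A → WithBot ℤ) (g : A → WithTop ℤ) (m : V → ℤ)
    (hfg : ∀ e, lowerToEReal (f e) ≤ upperToEReal (g e))
    (hm : ∑ v, m v = 0)
    (L : Finset A)
    (hL : ∀ e ∈ L, ⊥ < f e ∧ lowerToEReal (f e) < upperToEReal (g e) ∧ g e < ⊤) :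
    ∃ (q : ℕ) (W : Fin q → Finset V), StrictAnti W ∧
      (∀ i, upperToEReal (D.inSum g (W i)) - lowerToEReal (D.outSum f (W i)) < ⊤) ∧
      ∀ z : A → ℤ, D.IsFeasible f g m z →
        (D.IsUpperMinimizer f g m L z ↔
          (∀ e, (∃ i, D.Leaves e (W i)) → (z e : WithBot ℤ) = f e) ∧
          (∀ e, e ∉ L → (∃ i, D.Enters e (W i)) → (z e : WithTop ℤ) = g e) ∧
          (∀ e ∈ L, D.numEntered W e = 1 →
            upperPred (g e) ≤ (z e : WithTop ℤ) ∧ (z e : WithTop ℤ) ≤ g e) ∧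
          (∀ e ∈ L, 2 ≤ D.numEntered W e → (z e : WithTop ℤ) = g e) ∧
          (∀ e ∈ L, (∀ i, ¬ D.Enters e (W i) ∧ ¬ D.Leaves e (W i)) →
            f e ≤ (z e : WithBot ℤ) ∧ (z e : WithTop ℤ) ≤ upperPred (g e))) := by
  have hfin := finiteOn_of_lt hL
  by_cases hex : ∃ z, D.IsFeasible f g m z
  swap
  · exact ⟨0, Fin.elim0, fun i => i.elim0, fun i => i.elim0, fun z hz => absurd ⟨z, hz⟩ hex⟩
  obtain ⟨z₀, hz₀, hmin⟩ : ∃ z₀, D.IsUpperMinimizer f g m L z₀ := by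
    obtain ⟨z, hz, hle⟩ := exists_minimalFor_of_wellFoundedLT (D.IsFeasible f g m)
      (fun x => (saturated L g x).card) hex
    exact ⟨z, hz, fun x hx => (le_total _ _).elim id fun h => hle hx h⟩
  obtain ⟨π, hπ⟩ := exists_potential (IsResidual f g z₀) (resCost L g z₀)
    (cost_nonneg_of_closed_trail ⟨hz₀, hmin⟩)
  have hs := slack_levelSet (D := D) hfin hz₀.2 hπ
  refine ⟨_, levelSet π, levelSet_strictAnti, cut_lt_top_of_slack hfin hs, fun z hz => ?_⟩
  rw [isUpperMinimizer_iff_slack hfin levelSet_strictAnti.antitone hz₀ hs hz]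
  have hnone (e : A) : (∀ i, ¬ D.Enters e (levelSet π i) ∧ ¬ D.Leaves e (levelSet π i)) ↔
      D.numEntered (levelSet π) e = 0 ∧ D.numLeft (levelSet π) e = 0 := by
    simp only [forall_and, ← not_exists, ← numEntered_pos, ← numLeft_pos, Nat.pos_iff_ne_zero,
      not_not]
  simp only [hnone, ← numEntered_pos, ← numLeft_pos]
  constructor
  · intro h
    exact ⟨fun e => (h e).leaves, fun e => (h e).enters,
      fun e he hk => ⟨(h e).enters_one he hk, (hz.2 e).2⟩, fun e => (h e).enters_two,
      fun e he hkl => ⟨(hz.2 e).1, (h e).neither he hkl.1 hkl.2⟩⟩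
  · rintro ⟨h₁, h₂, h₃, h₄, h₅⟩ e
    exact ⟨h₁ e, h₂ e, fun he hk => (h₃ e he hk).1, h₄ e, fun he hk hl => (h₅ e he ⟨hk, hl⟩).2⟩
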